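/- Let $k\ge 1$ and let $\bar X^{(1)},\dots,\bar X^{(k)}$ be discrete-time, time-homogeneous Markov chains with time indexed by $t\in\{0,1,2,\dots\}$ and countable state spaces $A_1,\dots,A_k$ respectively, each with a given initial distribution and transition matrix. Let $\bar Z$ be a time-homogeneous Markov chain with countable state space $C$, and let $f_i:A_i\to C$ ($1\le i\le k$) be maps such that $$\bigl(f_i(\bar X^{(i)}_t)\bigr)_{t\ge 0}\overset{\mathrm d}{=}\bar Z\qquad\text{for all } i=1,\dots,k.$$ Then there exists a time-homogeneous Markov chain $(X^{(1)}_t,\dots,X^{(k)}_t)_{t\ge 0}$ with state space $A_1\times\dots\times A_k$ such that 1. $(X^{(i)}_t)_{t\ge 0}\overset{\mathrm d}{=}\bar X^{(i)}$ for all $i$; 2. $f_i(X^{(i)}_t)=f_j(X^{(j)}_t)$ for all $i,j$ and all $t\ge 0$; 3. writing $Z_t=f_1(X^{(1)}_t)=\dots=f_k(X^{(k)}_t)$ and $Z=(Z_t)_{t\ge 0}$ (so that $Z\overset{\mathrm d}{=}\bar Z$), the marginal processes $X^{(1)},\dots,X^{(k)}$ are (mutually) conditionally independent given the entire process $Z$.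 Here $\overset{\mathrm d}{=}$ denotes equality in law of processes. -/

import Mathlib

open MeasureTheory ProbabilityTheory

universe u


/-- The process `X` is the discrete-time homogeneous Markov chain `MC(α, P)` under `μ`: its initial
distribution is `α` and its transition matrix is the stochastic matrix `P` (whose rows `P a` are
probability distributions on the countable state space `S`), i.e. for every `n` and all states
`x 0, …, x n`, the probability of `X 0 = x 0, …, X n = x n` is
`α (x 0) * P (x 0) (x 1) * ⋯ * P (x (n - 1)) (x n)`. -/
structure IsMC {Ω S : Type*} [MeasurableSpace Ω] [Countable S] [MeasurableSpace S]
    (μ : Measure Ω) (X : ℕ → Ω → S) (α : PMF S) (P : S → PMF S) : Prop where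
  measurable : ∀ t, Measurable (X t)
  path_prob : ∀ (n : ℕ) (x : ℕ → S),
    μ {ω | ∀ t ≤ n, X t ω = x t} = α (x 0) * ∏ t ∈ Finset.range n, P (x t) (x (t + 1))

/-- The process `X` is a time-homogeneous Markov chain under `μ`. -/
def IsHomogeneousMarkovChain {Ω S : Type*} [MeasurableSpace Ω] [Countable S] [MeasurableSpace S]
    (μ : Measure Ω) (X : ℕ → Ω → S) : Prop :=
  ∃ (α : PMF S) (P : S → PMF S), IsMC μ X α P

/-! Draw z from the law ν of Z̄ and then, independently over i, a trajectory of the i-th chain from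
its conditional law κ_i(z) given that its image is z. Marginals, matching images and conditional
independence come with the construction; the point is that the joint process is again a homogeneous
Markov chain.

This is Bayes' rule. After a prefix ending in a, the future of a chain depends on a only
(`exists_future_law`), and this holds for Z̄ too because Z̄ is itself Markov. Hence the conditional
probability given z of the prefix x_0, …, x_n with image c is p_n(x)/q_n(c) · h_i(x_n)(future of z)
if z starts with c, and 0 otherwise. Here p_n, q_n are path probabilities and h_i(a) is the density
of the image of the future from a against the future of Z̄ from f_i(a)
(`factor_kernel_pathCylinder`).

Multiplying over i and integrating over z, the joint path probability is w_n(x) H(x_n), with w_n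
built from one-step factors. Successive ratios therefore depend on the last two states only, as in a
Doob h-transform with H (`exists_coupling_step`), which forces the Markov property
(`isHomogeneousMarkovChain_of_step`). -/

/-- The set of trajectories that agree with `x` up to time `n`. -/
def pathCylinder {S : Type*} (n : ℕ) (x : ℕ → S) : Set (ℕ → S) := {w | ∀ t ≤ n, w t = x t}

/-- The trajectory `w` seen from time `n` on. -/
def pathShift {S : Type*} (n : ℕ) (w : ℕ → S) : ℕ → S := fun t ↦ w (n + t)

/-- The trajectory that follows `x` before time `n` and `y` from then on. -/
def pathConcat {S : Type*} (n : ℕ) (x y : ℕ → S) : ℕ → S :=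
  fun t ↦ if t < n then x t else y (t - n)

/-- The probability that the chain `MC(α, P)` starts with `x 0, …, x n`. -/
noncomputable def pathWeight {S : Type*} (α : PMF S) (P : S → PMF S) (n : ℕ) (x : ℕ → S) :
    ENNReal :=
  α (x 0) * ∏ t ∈ Finset.range n, P (x t) (x (t + 1))

/-! ### Trajectories, cylinders and path weights -/

section Paths

variable {S T : Type*}

@[simp]
lemma mem_pathCylinder {n : ℕ} {x w : ℕ → S} : w ∈ pathCylinder n x ↔ ∀ t ≤ n, w t = x t := Iff.rfl

lemma pathWeight_succ (α : PMF S) (P : S → PMF S) (n : ℕ) (x : ℕ → S) :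
    pathWeight α P (n + 1) x = pathWeight α P n x * P (x n) (x (n + 1)) := by
  simp [pathWeight, Finset.prod_range_succ, mul_assoc]

lemma pathWeight_ne_top (α : PMF S) (P : S → PMF S) (n : ℕ) (x : ℕ → S) :
    pathWeight α P n x ≠ ⊤ :=
  ENNReal.mul_ne_top (α.apply_ne_top _) (ENNReal.prod_ne_top fun _ _ ↦ (P _).apply_ne_top _)

lemma pathConcat_pathShift_of_mem {n : ℕ} {x w : ℕ → S} (hw : w ∈ pathCylinder n x) :
    pathConcat n x (pathShift n w) = w := by
  funext t
  by_cases ht : t < n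
  · simp [pathConcat, ht, hw t ht.le]
  · simp [pathConcat, pathShift, ht, Nat.add_sub_cancel' (not_lt.1 ht)]

lemma pathWeight_pathConcat (α : PMF S) (P : S → PMF S) (n j : ℕ) {x y : ℕ → S}
    (h : y 0 = x n) :
    pathWeight α P (n + j) (pathConcat n x y) =
      pathWeight α P n x * ∏ t ∈ Finset.range j, P (y t) (y (t + 1)) := by
  induction j with
  | zero =>
    have key : ∀ t ≤ n, pathConcat n x y t = x t := by
      intro t ht
      rcases ht.lt_or_eq with h' | rfl
      · simp [pathConcat, h']
      · simp [pathConcat, h]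
    have : ∏ t ∈ Finset.range n, P (pathConcat n x y t) (pathConcat n x y (t + 1)) =
        ∏ t ∈ Finset.range n, P (x t) (x (t + 1)) := by
      refine Finset.prod_congr rfl fun t ht ↦ ?_
      have := Finset.mem_range.1 ht
      rw [key t (by omega), key (t + 1) (by omega)]
    simp [pathWeight, this, key 0 (Nat.zero_le _)]
  | succ j ih =>
    rw [← add_assoc, pathWeight_succ, ih, Finset.prod_range_succ, mul_assoc]
    have h1 : ¬ n + j + 1 < n := by omega
    have h2 : n + j + 1 - n = j + 1 := by omega
    simp [pathConcat, h1, h2]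

variable [MeasurableSpace S] [MeasurableSpace T]

@[fun_prop]
lemma measurable_pathShift (n : ℕ) : Measurable (pathShift n : (ℕ → S) → ℕ → S) :=
  measurable_pi_lambda _ fun _ ↦ measurable_pi_apply _

@[fun_prop]
lemma measurable_pathConcat (n : ℕ) (x : ℕ → S) : Measurable (pathConcat n x) := by
  refine measurable_pi_lambda _ fun t ↦ ?_
  by_cases ht : t < n
  · simp only [pathConcat, ht, if_true]; fun_prop
  · simp only [pathConcat, ht, if_false]; fun_prop

lemma measurableSet_pathCylinder [MeasurableSingletonClass S] (n : ℕ) (x : ℕ → S) :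
    MeasurableSet (pathCylinder n x) := by
  have : pathCylinder n x = ⋂ t, ⋂ (_ : t ≤ n), (fun w : ℕ → S ↦ w t) ⁻¹' {x t} := by
    ext; simp
  rw [this]
  exact .iInter fun t ↦ .iInter fun _ ↦ measurable_pi_apply t (measurableSet_singleton _)

/-- Finite measures on the trajectories in a countable space are determined by cylinders. -/
lemma measure_ext_of_pathCylinder [Countable S] [MeasurableSingletonClass S] [Nonempty S]
    {μ ν : Measure (ℕ → S)} [IsFiniteMeasure μ]
    (h : ∀ n x, μ (pathCylinder n x) = ν (pathCylinder n x)) : μ = ν := by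
  have hres : ∀ n, μ.map (Preorder.frestrictLe (π := fun _ ↦ S) n) =
      ν.map (Preorder.frestrictLe (π := fun _ ↦ S) n) := by
    intro n
    refine Measure.ext_of_singleton fun y ↦ ?_
    have hpre : Preorder.frestrictLe (π := fun _ ↦ S) n ⁻¹' {y} =
        pathCylinder n (fun t ↦ if ht : t ≤ n then y ⟨t, by simpa using ht⟩
          else Classical.arbitrary S) := by
      ext w
      simp only [Set.mem_preimage, Set.mem_singleton_iff, funext_iff, Subtype.forall,
        Finset.mem_Iic, mem_pathCylinder]
      refine forall₂_congr fun t ht ↦ ?_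
      simp [ht, Preorder.frestrictLe]
    rw [Measure.map_apply (by fun_prop) (measurableSet_singleton _),
      Measure.map_apply (by fun_prop) (measurableSet_singleton _), hpre, h]
  -- Every finite set of times lies in an initial segment, so agreement up to each n gives all
  -- finite-dimensional marginals.
  have hlim : IsProjectiveLimit μ (fun I ↦ ν.map I.restrict) := by
    intro I
    have hI : I ⊆ Finset.Iic (I.sup id) := fun i hi ↦ Finset.mem_Iic.2 (Finset.le_sup (f := id) hi)
    have h2 : (I.restrict : (ℕ → S) → (I → S)) =
        Finset.restrict₂ (π := fun _ ↦ S) hI ∘ Preorder.frestrictLe (π := fun _ ↦ S) _ := rfl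
    rw [h2, ← Measure.map_map (by fun_prop) (by fun_prop), hres,
      Measure.map_map (by fun_prop) (by fun_prop), ← h2]
  have : IsFiniteMeasure ν := ⟨by
    have := congrArg (fun m ↦ m Set.univ) (hres 0)
    simp only at this
    rw [Measure.map_apply (by fun_prop) .univ, Measure.map_apply (by fun_prop) .univ] at this
    rw [← Set.preimage_univ (f := Preorder.frestrictLe (π := fun _ ↦ S) 0), ← this]
    exact measure_lt_top _ _⟩
  have : ∀ I : Finset ℕ, IsFiniteMeasure (ν.map (I.restrict : (ℕ → S) → (I → S))) := fun _ ↦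
    inferInstance
  exact hlim.unique (fun _ ↦ rfl)

end Paths

/-! ### Homogeneous Markov chains: future laws and a criterion -/

section Markov

variable {S : Type*} [Countable S] [MeasurableSpace S] [MeasurableSingletonClass S]
  {m : Measure (ℕ → S)} {α : PMF S} {P : S → PMF S}

/-- The probability of a cylinder under the law of a Markov chain. -/
lemma IsMC.map_pathCylinder {Ω : Type*} [MeasurableSpace Ω] {μ : Measure Ω} {X : ℕ → Ω → S}
    (h : IsMC μ X α P) (n : ℕ) (x : ℕ → S) :
    μ.map (fun ω t ↦ X t ω) (pathCylinder n x) = pathWeight α P n x := by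
  rw [Measure.map_apply (measurable_pi_lambda _ h.measurable) (measurableSet_pathCylinder n x)]
  exact h.path_prob n x

/-- After a prefix of positive probability, the law of the future of a homogeneous Markov chain
depends only on the last state. -/
lemma exists_future_law [IsFiniteMeasure m]
    (hm : ∀ n x, m (pathCylinder n x) = pathWeight α P n x) :
    ∃ K : S → Measure (ℕ → S), (∀ a, IsFiniteMeasure (K a)) ∧ ∀ n x,
      (m.restrict (pathCylinder n x)).map (pathShift n) = pathWeight α P n x • K (x n) := by
  classical
  have hcyl : ∀ n x j y, (m.restrict (pathCylinder n x)).map (pathShift n) (pathCylinder j y) =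
      pathWeight α P n x *
        if y 0 = x n then ∏ t ∈ Finset.range j, P (y t) (y (t + 1)) else 0 := by
    intro n x j y
    rw [Measure.map_apply (by fun_prop) (measurableSet_pathCylinder _ _),
      Measure.restrict_apply (measurable_pathShift n (measurableSet_pathCylinder _ _))]
    split_ifs with h
    · rw [← pathWeight_pathConcat α P n j h, ← hm]
      congr 1
      ext w
      simp only [Set.mem_inter_iff, Set.mem_preimage, mem_pathCylinder, pathShift, pathConcat]
      constructor
      · rintro ⟨h1, h2⟩ t ht
        split_ifs with htn
        · exact h2 t htn.le
        · have := h1 (t - n) (by omega)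
          rwa [Nat.add_sub_cancel' (not_lt.1 htn)] at this
      · intro hw
        refine ⟨fun t ht ↦ ?_, fun t ht ↦ ?_⟩
        · simpa using hw (n + t) (by omega)
        · have := hw t (by omega)
          rcases ht.lt_or_eq with h' | rfl
          · simpa [h'] using this
          · simpa [h] using this
    · rw [mul_zero]
      convert measure_empty (μ := m)
      refine Set.eq_empty_of_forall_notMem fun w hw ↦ h ?_
      have h1 := hw.1 0 (Nat.zero_le _)
      have h2 := hw.2 n le_rfl
      simpa [pathShift, h2] using h1.symm
  -- The normalised future law has the same cylinder probabilities for any two prefixes of positive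
  -- weight with the same last state.
  have huniq : ∀ n x n' x', x n = x' n' → pathWeight α P n x ≠ 0 → pathWeight α P n' x' ≠ 0 →
      (pathWeight α P n x)⁻¹ • (m.restrict (pathCylinder n x)).map (pathShift n) =
      (pathWeight α P n' x')⁻¹ • (m.restrict (pathCylinder n' x')).map (pathShift n') := by
    intro n x n' x' h h0 h0'
    have : Nonempty S := ⟨x 0⟩
    have := Measure.smul_finite ((m.restrict (pathCylinder n x)).map (pathShift n))
      (ENNReal.inv_ne_top.2 h0)
    refine measure_ext_of_pathCylinder fun j y ↦ ?_
    rw [Measure.smul_apply, Measure.smul_apply, hcyl, hcyl, smul_eq_mul, smul_eq_mul, ← mul_assoc,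
      ← mul_assoc, ENNReal.inv_mul_cancel h0 (pathWeight_ne_top _ _ _ _),
      ENNReal.inv_mul_cancel h0' (pathWeight_ne_top _ _ _ _), h]
  -- States reached with positive probability. Elsewhere the value 0 is harmless, as it only meets
  -- weight 0.
  let R : S → Prop := fun a ↦ ∃ (n : ℕ) (x : ℕ → S), pathWeight α P n x ≠ 0 ∧ x n = a
  refine ⟨fun a ↦ if h : R a then (pathWeight α P h.choose h.choose_spec.choose)⁻¹ •
    (m.restrict (pathCylinder h.choose h.choose_spec.choose)).map (pathShift h.choose) else 0,
    fun a ↦ ?_, fun n x ↦ ?_⟩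
  · simp only
    split_ifs with h
    · exact Measure.smul_finite _ (ENNReal.inv_ne_top.2 h.choose_spec.choose_spec.1)
    · infer_instance
  · by_cases h0 : pathWeight α P n x = 0
    · have : m (pathCylinder n x) = 0 := by rw [hm, h0]
      simp [h0, Measure.restrict_eq_zero.2 this]
    · have h : R (x n) := ⟨n, x, h0, rfl⟩
      simp only [h, dif_pos]
      rw [huniq _ _ n x h.choose_spec.choose_spec.2 h.choose_spec.choose_spec.1 h0, smul_smul,
        ENNReal.mul_inv_cancel h0 (pathWeight_ne_top _ _ _ _), one_smul]

/-- A process whose path probabilities are multiplied, in each step, by a factor that depends only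
on the last two states is a homogeneous Markov chain. -/
lemma isHomogeneousMarkovChain_of_step {Ω : Type*} [MeasurableSpace Ω] {μ : Measure Ω}
    [IsProbabilityMeasure μ] {X : ℕ → Ω → S} (hX : ∀ t, Measurable (X t)) (R : S → S → ENNReal)
    (hR : ∀ (n : ℕ) (x : ℕ → S), μ {ω | ∀ t ≤ n + 1, X t ω = x t} =
      μ {ω | ∀ t ≤ n, X t ω = x t} * R (x n) (x (n + 1))) :
    IsHomogeneousMarkovChain μ X := by
  classical
  have hmeas : ∀ n (x : ℕ → S), MeasurableSet {ω | ∀ t ≤ n, X t ω = x t} := fun n x ↦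
    (measurable_pi_lambda (fun ω t ↦ X t ω) hX) (measurableSet_pathCylinder n x)
  have hsplit : ∀ (Y : Ω → S) (_ : Measurable Y) (E : Set Ω) (_ : MeasurableSet E),
      ∑' b, μ (E ∩ Y ⁻¹' {b}) = μ E := by
    intro Y hY E hE
    rw [← measure_iUnion, ← Set.inter_iUnion]
    · congr 1
      ext ω
      simp
    · intro a b hab
      refine Set.disjoint_left.2 fun ω h1 h2 ↦ hab ?_
      exact (h1.2 : Y ω = a).symm.trans h2.2
    · exact fun b ↦ hE.inter (hY (measurableSet_singleton b))
  -- `R` is constrained only at visited states, so only there must its rows sum to 1.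
  have hsum : ∀ a, (∃ (n : ℕ) (x : ℕ → S), μ {ω | ∀ t ≤ n, X t ω = x t} ≠ 0 ∧ x n = a) →
      HasSum (R a) 1 := by
    rintro a ⟨n, x, h0, rfl⟩
    have h1 := hsplit (X (n + 1)) (hX _) _ (hmeas n x)
    have h2 : ∀ b, μ ({ω | ∀ t ≤ n, X t ω = x t} ∩ X (n + 1) ⁻¹' {b}) =
        μ {ω | ∀ t ≤ n, X t ω = x t} * R (x n) b := by
      intro b
      have := hR n (Function.update x (n + 1) b)
      have e1 : ∀ t ≤ n, Function.update x (n + 1) b t = x t := fun t ht ↦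
        Function.update_of_ne (by omega) _ _
      rw [Function.update_self, e1 n le_rfl] at this
      have e2 : {ω | ∀ t ≤ n, X t ω = Function.update x (n + 1) b t} =
          {ω | ∀ t ≤ n, X t ω = x t} := by
        ext ω; exact forall₂_congr fun t ht ↦ by rw [e1 t ht]
      rw [e2] at this
      rw [← this]
      congr 1
      ext ω
      simp only [Set.mem_inter_iff, Set.mem_ofPred_eq, Set.mem_preimage, Set.mem_singleton_iff]
      constructor
      · rintro ⟨h3, h4⟩ t ht
        rcases Nat.le_succ_iff.1 ht with h | rfl
        · rw [e1 t h]; exact h3 t h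
        · simpa using h4
      · exact fun h ↦ ⟨fun t ht ↦ e1 t ht ▸ h t (by omega), by simpa using h (n + 1) le_rfl⟩
    simp_rw [h2, ENNReal.tsum_mul_left] at h1
    have h3 : ∑' b, R (x n) b = 1 := by
      have := congrArg (fun z ↦ (μ {ω | ∀ t ≤ n, X t ω = x t})⁻¹ * z) h1
      simpa [← mul_assoc, ENNReal.inv_mul_cancel h0 (measure_ne_top _ _)] using this
    exact h3 ▸ ENNReal.summable.hasSum
  have hinit : HasSum (fun a ↦ μ (X 0 ⁻¹' {a})) 1 := by
    have h1 := hsplit (X 0) (hX 0) Set.univ .univ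
    simp only [Set.univ_inter, measure_univ] at h1
    exact h1 ▸ ENNReal.summable.hasSum
  -- Unvisited states get an arbitrary stochastic row, the point mass at the state itself.
  have hP : ∀ a, ∃ p : PMF S,
      (∃ (n : ℕ) (x : ℕ → S), μ {ω | ∀ t ≤ n, X t ω = x t} ≠ 0 ∧ x n = a) → ∀ b, p b = R a b := by
    intro a
    by_cases h : ∃ (n : ℕ) (x : ℕ → S), μ {ω | ∀ t ≤ n, X t ω = x t} ≠ 0 ∧ x n = a
    · exact ⟨⟨R a, hsum a h⟩, fun _ _ ↦ rfl⟩
    · exact ⟨PMF.pure a, fun h' ↦ absurd h' h⟩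
  choose P hP using hP
  refine ⟨⟨_, hinit⟩, P, hX, fun n x ↦ ?_⟩
  induction n with
  | zero =>
    simp only [Nat.le_zero, forall_eq, Finset.range_zero, Finset.prod_empty, mul_one]
    rfl
  | succ n ih =>
    rw [Finset.prod_range_succ, ← mul_assoc, ← ih, hR]
    by_cases h0 : μ {ω | ∀ t ≤ n, X t ω = x t} = 0
    · simp [h0]
    · rw [hP _ ⟨n, x, h0, rfl⟩]

end Markov

/-! ### Conditional law of a chain given its image -/

lemma measurable_pathMap {S T : Type*} [MeasurableSpace S] [DiscreteMeasurableSpace S]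
    [MeasurableSpace T] (f : S → T) : Measurable fun (w : ℕ → S) t ↦ f (w t) :=
  measurable_pi_lambda _ fun t ↦ (Measurable.of_discrete (f := f)).comp (measurable_pi_apply t)

lemma measurableSet_apply_eq {S : Type*} [MeasurableSpace S] [MeasurableSingletonClass S]
    (t : ℕ) (c : S) : MeasurableSet {z : ℕ → S | z t = c} :=
  (measurable_pi_apply (X := fun _ : ℕ ↦ S) t) (measurableSet_singleton c)

section FactorKernel

variable {S T : Type*} [MeasurableSpace S] [DiscreteMeasurableSpace S] [MeasurableSpace T]
  {m : Measure (ℕ → S)} {ν : Measure (ℕ → T)} {f : S → T}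

/-- Disintegration of a law on trajectories along the image process. -/
lemma exists_factor_kernel [Countable S] [IsProbabilityMeasure m] (hν : m.map (fun w t ↦ f (w t)) = ν) :
    ∃ κ : Kernel (ℕ → T) (ℕ → S), IsMarkovKernel κ ∧
      ∀ B E, MeasurableSet B → MeasurableSet E →
        ∫⁻ z in B, κ z E ∂ν = m ((fun w t ↦ f (w t)) ⁻¹' B ∩ E) := by
  have : Nonempty (ℕ → S) := nonempty_of_isProbabilityMeasure m
  refine ⟨condDistrib id (fun w t ↦ f (w t)) m, inferInstance, fun B E hB hE ↦ ?_⟩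
  rw [← hν, setLIntegral_map hB (Kernel.measurable_coe _ hE) (by fun_prop),
    setLIntegral_preimage_condDistrib (by fun_prop) aemeasurable_id hE hB, Set.preimage_id]

variable {κ : Kernel (ℕ → T) (ℕ → S)}

/-- Countability of `T` reduces the claim to null events indexed by a time t and a value c: the
image cannot be at c and not at c at time t. -/
lemma factor_kernel_fiber [Countable T] [DiscreteMeasurableSpace T] [IsProbabilityMeasure ν]
    (hκ : ∀ B E, MeasurableSet B → MeasurableSet E →
      ∫⁻ z in B, κ z E ∂ν = m ((fun w t ↦ f (w t)) ⁻¹' B ∩ E)) :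
    ∀ᵐ z ∂ν, ∀ᵐ w ∂κ z, ∀ t, f (w t) = z t := by
  have key : ∀ t c, ∀ᵐ z ∂ν, z t = c → κ z {w | f (w t) = c}ᶜ = 0 := by
    intro t c
    have hE : MeasurableSet {w : ℕ → S | f (w t) = c}ᶜ :=
      ((measurable_pathMap f) (measurableSet_apply_eq t c)).compl
    have h0 : ∫⁻ z in {z : ℕ → T | z t = c}, κ z {w | f (w t) = c}ᶜ ∂ν = 0 := by
      rw [hκ _ _ (measurableSet_apply_eq t c) hE]
      convert measure_empty (μ := m)
      exact Set.inter_compl_self _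
    rw [setLIntegral_eq_zero_iff (measurableSet_apply_eq t c) (Kernel.measurable_coe _ hE)] at h0
    exact h0
  filter_upwards [ae_all_iff.2 fun t ↦ ae_all_iff.2 (key t)] with z hz
  exact ae_all_iff.2 fun t ↦ hz t _ rfl

/-- The conditional probability of a cylinder of a Markov chain given a Markovian function of the
chain is a product of a function of the cylinder and a function of its last state and of the future
of the image process. -/
lemma factor_kernel_pathCylinder [Countable S] [Countable T] [DiscreteMeasurableSpace T]
    [IsProbabilityMeasure m] [IsProbabilityMeasure ν]
    (hν : m.map (fun w t ↦ f (w t)) = ν)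
    (hκ : ∀ B E, MeasurableSet B → MeasurableSet E →
      ∫⁻ z in B, κ z E ∂ν = m ((fun w t ↦ f (w t)) ⁻¹' B ∩ E))
    {α : PMF S} {P : S → PMF S} (hm : ∀ n x, m (pathCylinder n x) = pathWeight α P n x)
    {q : ℕ → (ℕ → T) → ENNReal} (hq : ∀ n c, ν (pathCylinder n c) = q n c)
    {L : T → Measure (ℕ → T)} [∀ a, IsFiniteMeasure (L a)]
    (hL : ∀ n c, (ν.restrict (pathCylinder n c)).map (pathShift n) = q n c • L (c n)) :
    ∃ h : S → (ℕ → T) → ENNReal, (∀ a, Measurable (h a)) ∧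
      ∀ n x c, (∀ t ≤ n, f (x t) = c t) → ∀ᵐ z ∂ν, κ z (pathCylinder n x) =
        (pathCylinder n c).indicator
          (fun z ↦ pathWeight α P n x / q n c * h (x n) (pathShift n z)) z := by
  obtain ⟨K, hK, hKm⟩ := exists_future_law hm
  refine ⟨fun a ↦ ((K a).map fun w t ↦ f (w t)).rnDeriv (L (f a)),
    fun a ↦ Measure.measurable_rnDeriv _ _, fun n x c hc ↦ ?_⟩
  have hxc : pathCylinder n x ⊆ (fun w t ↦ f (w t)) ⁻¹' pathCylinder n c := fun w hw t ht ↦ by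
    rw [← hc t ht, ← hw t ht]
  have hmeas : Measurable fun z : ℕ → T ↦ pathWeight α P n x / q n c *
      ((K (x n)).map fun w t ↦ f (w t)).rnDeriv (L (f (x n))) (pathShift n z) :=
    ((Measure.measurable_rnDeriv _ _).comp (measurable_pathShift n)).const_mul _
  refine ae_eq_of_forall_setLIntegral_eq_of_sigmaFinite
    (Kernel.measurable_coe _ (measurableSet_pathCylinder n x))
    (hmeas.indicator (measurableSet_pathCylinder n c)) fun B hB _ ↦ ?_
  rw [hκ B _ hB (measurableSet_pathCylinder n x)]
  by_cases hp : pathWeight α P n x = 0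
  · have : m (pathCylinder n x) = 0 := by rw [hm, hp]
    simp [hp, measure_mono_null Set.inter_subset_right this]
  -- The chain following `x` forces its image to follow `c`; comparing the two restricted future
  -- laws yields the absolute continuity needed for the density.
  have hle : pathWeight α P n x • (K (x n)).map (fun w t ↦ f (w t)) ≤ q n c • L (c n) := by
    rw [← Measure.map_smul, ← hKm, ← hL, ← hν, Measure.map_map (by fun_prop) (by fun_prop),
      Measure.restrict_map (by fun_prop) (measurableSet_pathCylinder n c),
      Measure.map_map (by fun_prop) (by fun_prop)]
    exact Measure.map_mono (Measure.restrict_mono hxc le_rfl) (by fun_prop)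
  have hac : (K (x n)).map (fun w t ↦ f (w t)) ≪ L (f (x n)) := by
    rw [hc n le_rfl]
    refine Measure.AbsolutelyContinuous.mk fun E _ h0 ↦ ?_
    have := hle E
    simpa [h0, hp] using this
  have hq0 : q n c ≠ 0 := by
    rw [← hq, ← hν, Measure.map_apply (by fun_prop) (measurableSet_pathCylinder n c)]
    refine fun h0 ↦ hp ?_
    rw [← hm]
    exact measure_mono_null hxc h0
  have hqt : q n c ≠ ⊤ := hq n c ▸ measure_ne_top _ _
  -- Futures which, glued after `c`, land in `B`: on the cylinder of `c`, the event `B` is an event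
  -- about the future alone.
  set D := pathConcat n c ⁻¹' B with hD
  have hDm : MeasurableSet D := measurable_pathConcat n c hB
  calc m ((fun w t ↦ f (w t)) ⁻¹' B ∩ pathCylinder n x)
      = (pathWeight α P n x • (K (x n)).map (fun w t ↦ f (w t))) D := by
        rw [← Measure.map_smul, ← hKm, Measure.map_map (by fun_prop) (by fun_prop),
          Measure.map_apply (by fun_prop) hDm, Measure.restrict_apply]
        · congr 1
          ext w
          refine and_congr_left fun hw ↦ ?_
          have := pathConcat_pathShift_of_mem (hxc hw)
          change (fun t ↦ f (w t)) ∈ B ↔ pathConcat n c (pathShift n fun t ↦ f (w t)) ∈ B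
          rw [this]
        · exact (by fun_prop : Measurable ((fun (w : ℕ → S) t ↦ f (w t)) ∘ pathShift n)) hDm
    _ = pathWeight α P n x / q n c * ∫⁻ ζ in D,
          ((K (x n)).map fun w t ↦ f (w t)).rnDeriv (L (f (x n))) ζ ∂(q n c • L (c n)) := by
        rw [Measure.restrict_smul, lintegral_smul_measure, ← hc n le_rfl,
          Measure.setLIntegral_rnDeriv hac, smul_eq_mul, ← mul_assoc,
          ENNReal.div_mul_cancel hq0 hqt, Measure.smul_apply, smul_eq_mul]
    _ = ∫⁻ z in B ∩ pathCylinder n c, pathWeight α P n x / q n c *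
          ((K (x n)).map fun w t ↦ f (w t)).rnDeriv (L (f (x n))) (pathShift n z) ∂ν := by
        rw [← hL, setLIntegral_map hDm (Measure.measurable_rnDeriv _ _) (by fun_prop),
          ← lintegral_const_mul' _ _ (ENNReal.div_ne_top (pathWeight_ne_top _ _ _ _) hq0),
          Measure.restrict_restrict (measurable_pathShift n hDm)]
        have : pathShift n ⁻¹' D ∩ pathCylinder n c = B ∩ pathCylinder n c := by
          ext z
          refine and_congr_left fun hz ↦ ?_
          simp only [Set.mem_preimage, hD]
          rw [pathConcat_pathShift_of_mem hz]
        rw [this]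
    _ = _ := by
        rw [setLIntegral_indicator (measurableSet_pathCylinder n c), Set.inter_comm]

end FactorKernel

/-! ### Product kernels and conditional independence -/

section KernelPi

variable {ι β : Type*} [Fintype ι] {Y : ι → Type*} [MeasurableSpace β]
  [∀ i, MeasurableSpace (Y i)]

/-- The product of finitely many Markov kernels with the same source. -/
noncomputable def kernelPi (κ : ∀ i, Kernel β (Y i)) [∀ i, IsMarkovKernel (κ i)] :
    Kernel β (∀ i, Y i) where
  toFun z := Measure.pi fun i ↦ κ i z
  measurable' := by
    refine Measurable.measure_of_isPiSystem_of_isProbabilityMeasure generateFrom_pi.symm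
      isPiSystem_pi ?_
    rintro _ ⟨s, hs, rfl⟩
    simp_rw [Measure.pi_pi]
    exact Finset.measurable_prod _ fun i _ ↦ Kernel.measurable_coe _ (hs i (Set.mem_univ i))

variable (κ : ∀ i, Kernel β (Y i)) [∀ i, IsMarkovKernel (κ i)]

lemma kernelPi_apply (z : β) : kernelPi κ z = Measure.pi fun i ↦ κ i z := rfl

instance : IsMarkovKernel (kernelPi κ) := ⟨fun z ↦ by rw [kernelPi_apply]; infer_instance⟩

lemma kernelPi_biInter_preimage (s : Finset ι) (E : ∀ i, Set (Y i)) (z : β) :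
    kernelPi κ z (⋂ i ∈ s, Function.eval i ⁻¹' E i) = ∏ i ∈ s, κ i z (E i) := by
  classical
  have : ⋂ i ∈ s, Function.eval i ⁻¹' E i =
      Set.pi Set.univ fun i ↦ if i ∈ s then E i else Set.univ := by
    ext w
    simp only [Set.mem_iInter, Set.mem_preimage, Function.eval, Set.mem_pi, Set.mem_univ,
      true_implies]
    refine forall_congr' fun i ↦ ?_
    split_ifs with h <;> simp [h]
  rw [this, kernelPi_apply, Measure.pi_pi, ← Finset.prod_subset (Finset.subset_univ s)]
  · exact Finset.prod_congr rfl fun i hi ↦ by simp [hi]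
  · intro i _ hi
    simp [hi]

lemma kernelPi_preimage_eval (i : ι) (E : Set (Y i)) (z : β) :
    kernelPi κ z (Function.eval i ⁻¹' E) = κ i z E := by
  classical
  simpa using kernelPi_biInter_preimage κ {i} (Function.update (fun _ ↦ Set.univ) i E) z

/-- Random variables whose joint law with `Z` disintegrates into product measures are conditionally
independent given `Z`. -/
lemma iCondIndepFun_of_map_eq_compProd {Ω : Type*} [MeasurableSpace Ω] [StandardBorelSpace Ω]
    [∀ i, StandardBorelSpace (Y i)] {μ : Measure Ω} [IsProbabilityMeasure μ] {Z : Ω → β}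
    (hZ : Measurable Z) {X : ∀ i, Ω → Y i} (hX : ∀ i, Measurable (X i))
    (h : μ.map (fun ω ↦ (Z ω, fun i ↦ X i ω)) = μ.map Z ⊗ₘ kernelPi κ) :
    iCondIndepFun (MeasurableSpace.comap Z inferInstance) hZ.comap_le X μ := by
  have hXm : Measurable fun ω i ↦ X i ω := measurable_pi_lambda _ hX
  have : Nonempty (∀ i, Y i) := (nonempty_of_isProbabilityMeasure μ).map fun ω i ↦ X i ω
  -- Uniqueness of disintegration: the product kernel is the conditional law of the family given
  -- `Z`.
  have hcond := ae_of_ae_map hZ.aemeasurable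
    (condDistrib_ae_eq_of_measure_eq_compProd Z hXm.aemeasurable h)
  have key : ∀ E, MeasurableSet E → (fun ω ↦ (kernelPi κ (Z ω)).real E) =ᵐ[μ]
      μ⟦(fun ω i ↦ X i ω) ⁻¹' E | MeasurableSpace.comap Z inferInstance⟧ := by
    intro E hE
    refine Filter.EventuallyEq.trans ?_ (condDistrib_ae_eq_condExp hZ hXm hE)
    filter_upwards [hcond] with ω hω
    rw [hω]
  rw [iCondIndepFun_iff_condExp_inter_preimage_eq_mul _ _ hX]
  intro s sets hs
  have h1 := key (⋂ i ∈ s, Function.eval i ⁻¹' sets i)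
    (Finset.measurableSet_biInter s fun i hi ↦ measurable_pi_apply i (hs i hi))
  have h2 : ∀ᵐ ω ∂μ, ∀ i ∈ s, (κ i (Z ω)).real (sets i) =
      (μ⟦X i ⁻¹' sets i | MeasurableSpace.comap Z inferInstance⟧) ω := by
    refine (ae_ball_iff s.countable_toSet).2 fun i hi ↦ ?_
    filter_upwards [key (Function.eval i ⁻¹' sets i) (measurable_pi_apply i (hs i hi))] with ω hω
    rw [Measure.real, kernelPi_preimage_eval] at hω
    exact hω
  have h3 : (fun ω i ↦ X i ω) ⁻¹' (⋂ i ∈ s, Function.eval i ⁻¹' sets i) =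
      ⋂ i ∈ s, X i ⁻¹' sets i := by
    ext; simp
  rw [h3] at h1
  filter_upwards [h1, h2] with ω h1 h2
  rw [← h1, Finset.prod_apply, Measure.real, kernelPi_biInter_preimage, ENNReal.toReal_prod]
  exact Finset.prod_congr rfl h2

end KernelPi

/-! ### Path probabilities of the coupling -/

section Coupling

variable {ι : Type*} [Fintype ι] {A : ι → Type*} {C : Type*} [∀ i, Countable (A i)]
  [∀ i, MeasurableSpace (A i)] [∀ i, DiscreteMeasurableSpace (A i)] [MeasurableSpace C]
  {ν : Measure (ℕ → C)} {f : ∀ i, A i → C} {κ : ∀ i, Kernel (ℕ → C) (ℕ → A i)}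

/-- Trajectories of all chains that disagree on the image process are not charged. -/
lemma lintegral_prod_factor_kernel_eq_zero
    (hfib : ∀ i, ∀ᵐ z ∂ν, ∀ᵐ w ∂κ i z, ∀ t, f i (w t) = z t) (n : ℕ) (x : ℕ → ∀ i, A i)
    {i j : ι} {t : ℕ} (ht : t ≤ n) (hne : f i (x t i) ≠ f j (x t j)) :
    ∫⁻ z, ∏ i, κ i z (pathCylinder n fun t ↦ x t i) ∂ν = 0 := by
  rw [lintegral_eq_zero_iff (Finset.measurable_prod _ fun i _ ↦
    Kernel.measurable_coe _ (measurableSet_pathCylinder _ _))]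
  have hnull : ∀ l z, (∀ᵐ w ∂κ l z, ∀ t, f l (w t) = z t) → f l (x t l) ≠ z t →
      κ l z (pathCylinder n fun t ↦ x t l) = 0 := by
    intro l z hz hl
    exact measure_eq_zero_iff_ae_notMem.2
      (hz.mono fun w hw hw' ↦ hl ((congrArg (f l) (hw' t ht)).symm.trans (hw t)))
  filter_upwards [hfib i, hfib j] with z hi hj
  by_cases h : f i (x t i) = z t
  · exact Finset.prod_eq_zero (Finset.mem_univ j) (hnull j z hj fun h' ↦ hne (h.trans h'.symm))
  · exact Finset.prod_eq_zero (Finset.mem_univ i) (hnull i z hi h)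

/-- The path probabilities of the conditionally independent coupling are multiplied, in each step,
by a factor that depends only on the last two states. -/
lemma exists_coupling_step [Countable C] [DiscreteMeasurableSpace C]
    {m : ∀ i, Measure (ℕ → A i)} [∀ i, IsProbabilityMeasure (m i)] [IsProbabilityMeasure ν]
    [∀ i, IsMarkovKernel (κ i)] (i₀ : ι) (hν : ∀ i, (m i).map (fun w t ↦ f i (w t)) = ν)
    (hκ : ∀ i B E, MeasurableSet B → MeasurableSet E →
      ∫⁻ z in B, κ i z E ∂ν = m i ((fun w t ↦ f i (w t)) ⁻¹' B ∩ E))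
    {α : ∀ i, PMF (A i)} {P : ∀ i, A i → PMF (A i)}
    (hm : ∀ i n x, m i (pathCylinder n x) = pathWeight (α i) (P i) n x)
    {γ : PMF C} {Q : C → PMF C} (hγ : ∀ n c, ν (pathCylinder n c) = pathWeight γ Q n c) :
    ∃ R : (∀ i, A i) → (∀ i, A i) → ENNReal, ∀ (n : ℕ) (x : ℕ → ∀ i, A i),
      ∫⁻ z, ∏ i, κ i z (pathCylinder (n + 1) fun t ↦ x t i) ∂ν =
        (∫⁻ z, ∏ i, κ i z (pathCylinder n fun t ↦ x t i) ∂ν) * R (x n) (x (n + 1)) := by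
  classical
  obtain ⟨L, hLf, hL⟩ := exists_future_law hγ
  choose h hh hcyl using fun i ↦ factor_kernel_pathCylinder (hν i) (hκ i) (hm i) hγ hL
  have hfib := fun i ↦ factor_kernel_fiber (hκ i)
  set M : ℕ → (ℕ → ∀ i, A i) → ENNReal := fun n x ↦
    ∫⁻ z, ∏ i, κ i z (pathCylinder n fun t ↦ x t i) ∂ν with hM
  -- The images agree on the relevant paths, so the index `i₀` merely names the common image.
  let H : (∀ i, A i) → ENNReal := fun a ↦ ∫⁻ ζ, ∏ i, h i (a i) ζ ∂L (f i₀ (a i₀))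
  let w : ℕ → (ℕ → ∀ i, A i) → ENNReal := fun n x ↦
    pathWeight γ Q n (fun t ↦ f i₀ (x t i₀)) * ∏ i,
      (pathWeight (α i) (P i) n (fun t ↦ x t i) / pathWeight γ Q n (fun t ↦ f i₀ (x t i₀)))
  have hMw : ∀ n x, (∀ i, ∀ t ≤ n, f i (x t i) = f i₀ (x t i₀)) → M n x = w n x * H (x n) := by
    intro n x hx
    set c : ℕ → C := fun t ↦ f i₀ (x t i₀) with hc
    have hae : ∀ᵐ z ∂ν, ∏ i, κ i z (pathCylinder n fun t ↦ x t i) =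
        (pathCylinder n c).indicator (fun z ↦
          (∏ i, (pathWeight (α i) (P i) n (fun t ↦ x t i) / pathWeight γ Q n c)) *
            ∏ i, h i (x n i) (pathShift n z)) z := by
      filter_upwards [ae_all_iff.2 fun i ↦ hcyl i n (fun t ↦ x t i) c (hx i)] with z hz
      rw [Finset.prod_congr rfl fun i _ ↦ hz i]
      by_cases hzc : z ∈ pathCylinder n c
      · simp only [Set.indicator_of_mem hzc, Finset.prod_mul_distrib]
      · simp only [Set.indicator_of_notMem hzc]
        exact Finset.prod_eq_zero (Finset.mem_univ i₀) rfl
    have hmeas : Measurable fun ζ ↦ ∏ i, h i (x n i) ζ :=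
      Finset.measurable_prod _ fun i _ ↦ hh i _
    have hint : ∫⁻ z in pathCylinder n c, ∏ i, h i (x n i) (pathShift n z) ∂ν =
        pathWeight γ Q n c * H (x n) :=
      (lintegral_map hmeas (measurable_pathShift n)).symm.trans
        (by rw [hL, lintegral_smul_measure, smul_eq_mul])
    have hmeas' : Measurable fun z ↦ ∏ i, h i (x n i) (pathShift n z) :=
      hmeas.comp (measurable_pathShift n)
    simp only [hM]
    rw [lintegral_congr_ae hae, lintegral_indicator (measurableSet_pathCylinder n c),
      lintegral_const_mul _ hmeas', hint, ← mul_assoc, mul_comm (∏ i, _) (pathWeight γ Q n c)]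
  have hMle : ∀ n x, M (n + 1) x ≤ M n x := by
    refine fun n x ↦ lintegral_mono fun z ↦ Finset.prod_le_prod' fun i _ ↦ measure_mono ?_
    exact fun w hw t ht ↦ hw t (by omega)
  have hMtop : ∀ n x, M n x ≠ ⊤ := by
    intro n x
    refine ne_top_of_le_ne_top ENNReal.one_ne_top
      ((lintegral_mono fun z ↦ Finset.prod_le_one' fun i _ ↦ prob_le_one).trans ?_)
    simp
  -- The ratio of consecutive values of w_n H. If `H a = 0`, the path already has probability 0 and
  -- the quotient is irrelevant.
  refine ⟨fun a b ↦ if ∀ i, f i (b i) = f i₀ (b i₀) then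
    (Q (f i₀ (a i₀)) (f i₀ (b i₀)) * ∏ i, (P i (a i) (b i) / Q (f i₀ (a i₀)) (f i₀ (b i₀)))) *
      H b / H a else 0, fun n x ↦ ?_⟩
  change M (n + 1) x = M n x * _
  by_cases h0 : M n x = 0
  · rw [h0, zero_mul]
    exact le_antisymm ((hMle n x).trans h0.le) zero_le
  have hx : ∀ i, ∀ t ≤ n, f i (x t i) = f i₀ (x t i₀) := by
    intro i t ht
    by_contra hne
    exact h0 (lintegral_prod_factor_kernel_eq_zero hfib n x ht hne)
  beta_reduce
  split_ifs with hb
  · have hx' : ∀ i, ∀ t ≤ n + 1, f i (x t i) = f i₀ (x t i₀) := by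
      intro i t ht
      rcases Nat.le_succ_iff.1 ht with h | rfl
      · exact hx i t h
      · exact hb i
    have hMn := hMw n x hx
    rw [hMw _ _ hx', hMn]
    have hH0 : H (x n) ≠ 0 := fun h ↦ h0 (by rw [hMn, h, mul_zero])
    have hw0 : w n x ≠ 0 := fun h ↦ h0 (by rw [hMn, h, zero_mul])
    have hHt : H (x n) ≠ ⊤ := fun h ↦ hMtop n x (by rw [hMn, h, ENNReal.mul_top hw0])
    have hws : w (n + 1) x = w n x * (Q (f i₀ (x n i₀)) (f i₀ (x (n + 1) i₀)) *
        ∏ i, (P i (x n i) (x (n + 1) i) / Q (f i₀ (x n i₀)) (f i₀ (x (n + 1) i₀)))) := by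
      simp only [w, pathWeight_succ]
      rw [mul_mul_mul_comm, ← Finset.prod_mul_distrib]
      congr 1
      refine Finset.prod_congr rfl fun i _ ↦ ?_
      rw [div_eq_mul_inv, ENNReal.mul_inv (Or.inr (PMF.apply_ne_top _ _))
        (Or.inl (pathWeight_ne_top _ _ _ _)), mul_mul_mul_comm, div_eq_mul_inv, div_eq_mul_inv]
    rw [hws, mul_assoc (w n x) (H (x n)), ENNReal.mul_div_cancel hH0 hHt, mul_assoc]
  · push Not at hb
    obtain ⟨i, hi⟩ := hb
    rw [mul_zero]
    exact lintegral_prod_factor_kernel_eq_zero hfib (n + 1) x le_rfl hi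

end Coupling

/-! ### The coupling on matching trajectories, and the theorem -/

lemma measurableSet_pathMap_eq {ι : Type*} [Countable ι] {A : ι → Type*} {C : Type*}
    [∀ i, MeasurableSpace (A i)] [∀ i, DiscreteMeasurableSpace (A i)]
    [Countable C] [MeasurableSpace C] [DiscreteMeasurableSpace C] (f : ∀ i, A i → C) :
    MeasurableSet {w : ∀ i, ℕ → A i | ∀ i j t, f i (w i t) = f j (w j t)} := by
  simp only [Set.ofPred_forall]
  exact .iInter fun i ↦ .iInter fun j ↦ .iInter fun t ↦
    measurableSet_eq_fun (by fun_prop) (by fun_prop)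

/-- Conditionally independent couplings of laws on trajectories with a common image law live on the
families of trajectories whose images agree. -/
lemma exists_conditionallyIndependent_coupling {ι : Type*} [Fintype ι] {A : ι → Type*} {C : Type*}
    [∀ i, Countable (A i)] [∀ i, MeasurableSpace (A i)] [∀ i, DiscreteMeasurableSpace (A i)]
    [Countable C] [MeasurableSpace C] [DiscreteMeasurableSpace C]
    {ν : Measure (ℕ → C)} [IsProbabilityMeasure ν] {f : ∀ i, A i → C}
    {κ : ∀ i, Kernel (ℕ → C) (ℕ → A i)} [∀ i, IsMarkovKernel (κ i)] (i₀ : ι)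
    (hfib : ∀ i, ∀ᵐ z ∂ν, ∀ᵐ w ∂κ i z, ∀ t, f i (w t) = z t) :
    ∃ μ : Measure {w : ∀ i, ℕ → A i // ∀ i j t, f i (w i t) = f j (w j t)},
      μ.map (fun ω ↦ ((fun t ↦ f i₀ (ω.1 i₀ t)), ω.1)) = ν ⊗ₘ kernelPi κ := by
  have hae : ∀ᵐ p ∂(ν ⊗ₘ kernelPi κ), ∀ i t, f i (p.2 i t) = p.1 t := by
    refine Measure.ae_compProd_of_ae_ae ?_ ?_
    · simp only [Set.ofPred_forall]
      refine .iInter fun i ↦ .iInter fun t ↦ measurableSet_eq_fun ?_ ?_ <;> fun_prop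
    · filter_upwards [ae_all_iff.2 hfib] with z hz
      rw [kernelPi_apply]
      exact ae_all_iff.2 fun i ↦
        (Measure.quasiMeasurePreserving_eval (fun i ↦ κ i z) i).ae (hz i)
  have hmeas := measurableSet_pathMap_eq f
  -- Matching holds almost surely, so pulling back to the subtype loses no mass and makes it hold at
  -- every sample point.
  refine ⟨(ν ⊗ₘ kernelPi κ).snd.comap Subtype.val, ?_⟩
  have hval : ((ν ⊗ₘ kernelPi κ).snd.comap Subtype.val).map (Subtype.val :
      {w : ∀ i, ℕ → A i // ∀ i j t, f i (w i t) = f j (w j t)} → _) = (ν ⊗ₘ kernelPi κ).snd := by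
    refine (map_comap_subtype_coe hmeas _).trans (Measure.restrict_eq_self_of_ae_mem ?_)
    refine (ae_map_iff (by fun_prop) hmeas).2 ?_
    filter_upwards [hae] with p hp i j t
    rw [hp, hp]
  have hF : Measurable fun w : ∀ i, ℕ → A i ↦ ((fun t ↦ f i₀ (w i₀ t)), w) := by fun_prop
  calc _ = (((ν ⊗ₘ kernelPi κ).snd.comap Subtype.val).map (Subtype.val :
      {w : ∀ i, ℕ → A i // ∀ i j t, f i (w i t) = f j (w j t)} → _)).map
        fun w ↦ ((fun t ↦ f i₀ (w i₀ t)), w) := (Measure.map_map hF measurable_subtype_coe).symm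
    _ = (ν ⊗ₘ kernelPi κ).map fun p ↦ ((fun t ↦ f i₀ (p.2 i₀ t)), p.2) := by
      rw [hval, Measure.snd, Measure.map_map hF measurable_snd]
      rfl
    _ = (ν ⊗ₘ kernelPi κ).map id := by
      refine Measure.map_congr ?_
      filter_upwards [hae] with p hp
      exact Prod.ext (funext fun t ↦ hp i₀ t) rfl
    _ = _ := Measure.map_id

theorem mainTheorem8 (k : ℕ) (hk : 1 ≤ k)
    -- the countable state spaces, with the discrete measurable structure
    (A : Fin k → Type u) [∀ i, Countable (A i)] [∀ i, MeasurableSpace (A i)]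
    [∀ i, DiscreteMeasurableSpace (A i)]
    (C : Type*) [Countable C] [MeasurableSpace C] [DiscreteMeasurableSpace C]
    -- the given chains, each on its own probability space
    (Ωb : Fin k → Type*) [∀ i, MeasurableSpace (Ωb i)]
    (μb : ∀ i, Measure (Ωb i)) [∀ i, IsProbabilityMeasure (μb i)]
    (Xb : ∀ i, ℕ → Ωb i → A i) (hXb : ∀ i, IsHomogeneousMarkovChain (μb i) (Xb i))
    (ΩZ : Type*) [MeasurableSpace ΩZ] (μZ : Measure ΩZ) [IsProbabilityMeasure μZ]
    (Zb : ℕ → ΩZ → C) (hZb : IsHomogeneousMarkovChain μZ Zb)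
    (f : ∀ i, A i → C)
    -- equality in law of processes, as random elements of the trajectory space `ℕ → C`
    (hf : ∀ i, IdentDistrib (fun ω t ↦ f i (Xb i t ω)) (fun ω t ↦ Zb t ω) (μb i) μZ) :
    ∃ (Ω : Type u) (_ : MeasurableSpace Ω) (_ : StandardBorelSpace Ω)
      (μ : Measure Ω) (_ : IsProbabilityMeasure μ) (X : ℕ → Ω → ∀ i, A i),
      IsHomogeneousMarkovChain μ X ∧
      (∀ i, IdentDistrib (fun ω t ↦ X t ω i) (fun ω t ↦ Xb i t ω) μ (μb i)) ∧
      (∀ i j t ω, f i (X t ω i) = f j (X t ω j)) ∧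
      ∃ (Z : Ω → ℕ → C) (hZ : Measurable Z),
        (∀ i t ω, Z ω t = f i (X t ω i)) ∧
        IdentDistrib Z (fun ω t ↦ Zb t ω) μ μZ ∧
        -- conditional independence of the whole trajectories given the whole trajectory of `Z`
        iCondIndepFun (MeasurableSpace.comap Z inferInstance) hZ.comap_le
          (fun i ω t ↦ X t ω i) μ := by
  obtain ⟨γ, Q, hZmc⟩ := hZb
  choose α P hXmc using hXb
  let i₀ : Fin k := ⟨0, hk⟩
  have hZm : Measurable fun ω t ↦ Zb t ω := measurable_pi_lambda _ hZmc.measurable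
  have hXm : ∀ i, Measurable fun ω t ↦ Xb i t ω := fun i ↦
    measurable_pi_lambda _ (hXmc i).measurable
  let ν : Measure (ℕ → C) := μZ.map fun ω t ↦ Zb t ω
  let m : ∀ i, Measure (ℕ → A i) := fun i ↦ (μb i).map fun ω t ↦ Xb i t ω
  have : IsProbabilityMeasure ν := Measure.isProbabilityMeasure_map hZm.aemeasurable
  have : ∀ i, IsProbabilityMeasure (m i) := fun i ↦
    Measure.isProbabilityMeasure_map (hXm i).aemeasurable
  have hν : ∀ i, (m i).map (fun w t ↦ f i (w t)) = ν := fun i ↦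
    (Measure.map_map (measurable_pathMap (f i)) (hXm i)).trans (hf i).map_eq
  choose κ hκM hκ using fun i ↦ exists_factor_kernel (hν i)
  obtain ⟨R, hR⟩ := exists_coupling_step i₀ hν hκ (fun i ↦ (hXmc i).map_pathCylinder)
    hZmc.map_pathCylinder
  obtain ⟨μ, hμ⟩ := exists_conditionallyIndependent_coupling i₀
    fun i ↦ factor_kernel_fiber (hκ i)
  let Ω := {w : ∀ i, ℕ → A i // ∀ i j t, f i (w i t) = f j (w j t)}
  have hΩ : StandardBorelSpace Ω := (measurableSet_pathMap_eq f).standardBorel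
  let Z : Ω → ℕ → C := fun ω t ↦ f i₀ (ω.1 i₀ t)
  have hcoord : ∀ i, Measurable fun ω : Ω ↦ ω.1 i := fun i ↦
    (measurable_pi_apply i).comp measurable_subtype_coe
  have hZ : Measurable Z := (measurable_pathMap (f i₀)).comp (hcoord i₀)
  have hpair : Measurable fun ω : Ω ↦ (Z ω, ω.1) := hZ.prodMk measurable_subtype_coe
  have hprob : IsProbabilityMeasure μ := by
    have : IsProbabilityMeasure (μ.map fun ω : Ω ↦ (Z ω, ω.1)) := hμ ▸ inferInstance
    exact Measure.isProbabilityMeasure_of_map fun ω : Ω ↦ (Z ω, ω.1)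
  have hjoint : ∀ B E, MeasurableSet B → MeasurableSet E →
      μ {ω | Z ω ∈ B ∧ ω.1 ∈ E} = ∫⁻ z in B, kernelPi κ z E ∂ν := by
    intro B E hB hE
    rw [← Measure.compProd_apply_prod hB hE, ← hμ, Measure.map_apply hpair (hB.prod hE)]
    rfl
  have hZlaw : μ.map Z = ν := by
    ext B hB
    rw [Measure.map_apply hZ hB]
    simpa [Set.preimage] using hjoint B Set.univ hB .univ
  refine ⟨Ω, inferInstance, hΩ, μ, hprob, fun t ω i ↦ ω.1 i t, ?_, fun i ↦ ?_,
    fun i j t ω ↦ ω.2 i j t, Z, hZ, fun i t ω ↦ ω.2 i₀ i t,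
    ⟨hZ.aemeasurable, hZm.aemeasurable, hZlaw⟩, ?_⟩
  · refine isHomogeneousMarkovChain_of_step (fun t ↦ measurable_pi_lambda _ fun i ↦
      (measurable_pi_apply t).comp (hcoord i)) R fun n x ↦ ?_
    have hpath : ∀ n, μ {ω : Ω | ∀ t ≤ n, (fun i ↦ ω.1 i t) = x t} =
        ∫⁻ z, ∏ i, κ i z (pathCylinder n fun t ↦ x t i) ∂ν := by
      intro n
      have h := hjoint Set.univ (Set.pi Set.univ fun i ↦ pathCylinder n fun t ↦ x t i) .univ
        (.univ_pi fun i ↦ measurableSet_pathCylinder _ _)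
      simp only [kernelPi_apply, Measure.pi_pi, Measure.restrict_univ] at h
      rw [← h]
      congr 1
      ext ω
      simp only [Set.mem_ofPred_eq, Set.mem_univ, true_and, Set.mem_pi, true_implies,
        mem_pathCylinder, funext_iff]
      exact ⟨fun h i t ht ↦ h t ht i, fun h t ht i ↦ h i t ht⟩
    rw [hpath, hpath, hR]
  · refine ⟨(hcoord i).aemeasurable, (hXm i).aemeasurable, ?_⟩
    ext E hE
    have h := hjoint Set.univ (Function.eval i ⁻¹' E) .univ (measurable_pi_apply i hE)
    simp only [kernelPi_preimage_eval] at h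
    rw [hκ i _ _ .univ hE] at h
    rw [Measure.map_apply (hcoord i) hE]
    simpa [Set.preimage] using h
  · exact iCondIndepFun_of_map_eq_compProd κ hZ hcoord (by rw [hZlaw]; exact hμ)
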